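/- Let $X_D$ and $X_G$ be independent real random variables with $\mathbb{E}[X_D^2]\le 1$ and $X_G\sim\mathcal N(0,1)$, let $\delta\in[0,1]$ and $\mathsf{snr}\ge 0$, and put $X_{\mathrm{mix}}=\sqrt{1-\delta}\,X_D+\sqrt{\delta}\,X_G$. For a real random variable $X$ and $s\ge 0$ let $Y=\sqrt{s}\,X+Z$ with $Z\sim\mathcal N(0,1)$ independent of $X$, and define $$I(X,s)=\mathbb{E}\left[\log\frac{p_{Y|X}(Y|X)}{p_Y(Y)}\right],\qquad \mathrm{mmse}(X,s)=\mathbb{E}\big[\mathbb{E}[(X-\mathbb{E}[X|Y])^2\,|\,Y]\big],$$ where $\log$ is the natural logarithm, $p_Y$ is the density of $Y$ and $p_{Y|X}$ is the conditional density of $Y$ given $X$ (with respect to Lebesgue measure); both quantities depend only on $s$ and the distribution of $X$. Then the expectations defining the three mutual informations below are those of integrable random variables, and $$I(X_{\mathrm{mix}},\mathsf{snr})=I\left(X_D,\frac{\mathsf{snr}(1-\delta)}{1+\delta\,\mathsf{snr}}\right)+I(X_G,\delta\,\mathsf{snr}),$$ $$\mathrm{mmse}(X_{\mathrm{mix}},\mathsf{snr})=\frac{1-\delta}{(1+\delta\,\mathsf{snr})^2}\,\mathrm{mmse}\left(X_D,\frac{\mathsf{snr}(1-\delta)}{1+\delta\,\mathsf{snr}}\right)+\delta\,\mathrm{mmse}(X_G,\delta\,\mathsf{snr}).$$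 -/

import Mathlib

open MeasureTheory ProbabilityTheory

/-- The mixed input `√(1-δ) X_D + √δ X_G`. -/
noncomputable def mixedInput {Ω : Type*} (δ : ℝ) (XD XG : Ω → ℝ) : Ω → ℝ :=
  fun ω => √(1 - δ) * XD ω + √δ * XG ω

/-- The output `Y = √snr X + Z` of the additive noise channel with input `X` and noise `Z`. -/
noncomputable def channelOutput {Ω : Type*} (snr : ℝ) (X Z : Ω → ℝ) : Ω → ℝ :=
  fun ω => √snr * X ω + Z ω

/-- The conditional density `(x, y) ↦ p_{Y|X}(y|x)` of `Y` given `X` with respect to Lebesgue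
measure: the jointly measurable function (unique almost everywhere) with
`P(X ∈ A, Y ∈ B) = ∫_A ∫_B p_{Y|X}(y|x) dy dP_X(x)`, provided that such a function exists. -/
noncomputable def condDensity {Ω : Type*} [MeasurableSpace Ω] (P : Measure Ω) (X Y : Ω → ℝ) :
    ℝ × ℝ → ℝ :=
  fun p => ((P.map (fun ω => (X ω, Y ω))).rnDeriv ((P.map X).prod volume) p).toReal

/-- The information density `log (p_{Y|X}(Y|X) / p_Y(Y))` as a random variable (natural
logarithm), where `p_Y` is the Lebesgue density of the law of `Y`. -/
noncomputable def infoDensity {Ω : Type*} [MeasurableSpace Ω] (P : Measure Ω) (X Y : Ω → ℝ) :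
    Ω → ℝ :=
  fun ω => Real.log (condDensity P X Y (X ω, Y ω) / (pdf Y P volume (Y ω)).toReal)

/-- The mutual information `I(X;Y) = 𝔼[log (p_{Y|X}(Y|X) / p_Y(Y))]`, in nats. -/
noncomputable def mutualInfo {Ω : Type*} [MeasurableSpace Ω] (P : Measure Ω) (X Y : Ω → ℝ) : ℝ :=
  ∫ ω, infoDensity P X Y ω ∂P

/-- The minimum mean squared error `mmse(X|Y) = 𝔼[𝔼[(X - 𝔼[X|Y])² | Y]]` of estimating the real
random variable `X` from `Y`. -/
noncomputable def mmse {Ω : Type*} [MeasurableSpace Ω] (P : Measure Ω) (X Y : Ω → ℝ) : ℝ :=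
  ∫ ω, (condVar (MeasurableSpace.comap Y inferInstance) X P) ω ∂P

/-! With `a = 1 + δ snr`, the output is `√snr √(1-δ) X_D + N`, where `N = √(δ snr) X_G + Z` has law
`N(0, a)`. So the Gaussian part of the input acts as extra noise: in law, the output is `√a` times
that of the `X_D`-channel at the reduced snr (`mixture_channel`).

Information: `I(X, s)` is the entropy of the output minus that of the noise (`mutualInfo_channel`),
and scaling by `√a` adds `log √a` to an entropy (`negEntropy_map_const_mul`). The same `log √a` is
`I(X_G, δ snr)`, whose output is `√a` times a standard Gaussian in law.

Estimation: the residual `V` of `X_G` regressed on `N` is independent of `N`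
(`gaussian_regression`), hence of `(X_D, Y)`. Eliminating `N` gives `X_mix = (√(1-δ)/a) X_D + b Y +
√δ V` for a constant `b`. Here `b Y` is known and `V` adds its variance (`mmse_affine_add_indep`);
moreover `Var V = 1/a = mmse(X_G, δ snr)`.

The noise is only assumed independent of the mixture, not of the pair `(X_D, X_G)`, so the
estimation argument runs on a product space with full independence (`exists_canonical_mixture`) and
is transferred through joint laws. -/

/-! ### Minimum mean squared error and Gaussian regression -/

section Mmse

variable {Ω Ω' : Type*} [MeasurableSpace Ω] [MeasurableSpace Ω'] {P : Measure Ω} {P' : Measure Ω'}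

lemma mmse_eq_integral_sub_condExp_sq [IsFiniteMeasure P] (X : Ω → ℝ) {Y : Ω → ℝ}
    (hY : Measurable Y) :
    mmse P X Y =
      ∫ ω, (X ω - (P[X | MeasurableSpace.comap Y inferInstance]) ω) ^ 2 ∂P := by
  rw [mmse, condVar, integral_condExp hY.comap_le]
  rfl

/-- The integrand involves only the conditional distribution, which the joint law determines; this
yields invariance in law. -/
lemma mmse_eq_integral_condDistrib [IsFiniteMeasure P] {X Y : Ω → ℝ} (hX : Integrable X P)
    (hXm : Measurable X) (hY : Measurable Y) :
    mmse P X Y = ∫ p : ℝ × ℝ, (p.2 - ∫ x, x ∂(condDistrib X Y P p.1)) ^ 2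
      ∂(P.map fun ω => (Y ω, X ω)) := by
  have hm : StronglyMeasurable fun y : ℝ => ∫ x, x ∂(condDistrib X Y P y) :=
    MeasureTheory.StronglyMeasurable.integral_kernel stronglyMeasurable_id
  rw [mmse_eq_integral_sub_condExp_sq X hY, integral_map (by fun_prop)]
  · refine integral_congr_ae ?_
    filter_upwards [condExp_ae_eq_integral_condDistrib' hY hX] with ω hω
    rw [hω]
  · exact ((measurable_snd.sub (hm.measurable.comp measurable_fst)).pow_const 2).aestronglyMeasurable

/-- The minimum mean squared error depends on the joint law only. -/
lemma mmse_eq_of_map_eq [IsFiniteMeasure P] [IsFiniteMeasure P'] {X Y : Ω → ℝ} {X' Y' : Ω' → ℝ}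
    (hX : Integrable X P) (hX' : Integrable X' P')
    (hXm : Measurable X) (hY : Measurable Y) (hXm' : Measurable X') (hY' : Measurable Y')
    (h : P.map (fun ω => (Y ω, X ω)) = P'.map (fun ω => (Y' ω, X' ω))) :
    mmse P X Y = mmse P' X' Y' := by
  rw [mmse_eq_integral_condDistrib hX hXm hY, mmse_eq_integral_condDistrib hX' hXm' hY']
  simp only [condDistrib, h]

/-- A nonzero rescaling is a measurable equivalence, so both observations generate the same
σ-algebra. -/
lemma mmse_const_mul_right (X Y : Ω → ℝ) {c : ℝ} (hc : c ≠ 0) :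
    mmse P X (fun ω => c * Y ω) = mmse P X Y := by
  have : MeasurableSpace.comap (fun ω => c * Y ω) inferInstance
      = MeasurableSpace.comap Y inferInstance := by
    have h : (fun ω => c * Y ω) = (Homeomorph.mulLeft₀ c hc).toMeasurableEquiv ∘ Y := rfl
    rw [h, ← MeasurableSpace.comap_comp, MeasurableEquiv.measurableEmbedding _ |>.comap_eq]
  rw [mmse, mmse, this]

/-- Noise that is independent of the estimated variable and of the observation adds its variance
to the minimum mean squared error. -/
lemma mmse_affine_add_indep [IsProbabilityMeasure P] {X Y V : Ω → ℝ} (b c : ℝ)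
    (hY : Measurable Y) (hVm : Measurable V)
    (hX : MemLp X 2 P) (hYL : MemLp Y 2 P) (hV : MemLp V 2 P)
    (hind : IndepFun (fun ω => (X ω, Y ω)) V P) :
    mmse P (fun ω => c * X ω + b * Y ω + V ω) Y = c ^ 2 * mmse P X Y + Var[V; P] := by
  rw [mmse_eq_integral_sub_condExp_sq _ hY, mmse_eq_integral_sub_condExp_sq _ hY]
  set m : MeasurableSpace Ω := MeasurableSpace.comap Y inferInstance with hm
  have hX1 : Integrable X P := hX.integrable one_le_two
  have hY1 : Integrable Y P := hYL.integrable one_le_two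
  have hV1 : Integrable V P := hV.integrable one_le_two
  -- A Borel version of the regression function: `X - k(Y)` is then literally a measurable function
  -- of `(X, Y)`, so it inherits independence from `V`, and the cross term vanishes.
  set k : ℝ → ℝ := fun y => ∫ x, x ∂(condDistrib X Y P y) with hk
  have hkm : Measurable k :=
    (MeasureTheory.StronglyMeasurable.integral_kernel stronglyMeasurable_id).measurable
  have hXk : P[X | m] =ᵐ[P] fun ω => k (Y ω) := condExp_ae_eq_integral_condDistrib' hY hX1
  have hVc : P[V | m] =ᵐ[P] fun _ => P[V] := by
    refine condExp_indep_eq (m₁ := MeasurableSpace.comap V inferInstance) hVm.comap_le hY.comap_le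
      (comap_measurable V).stronglyMeasurable ?_
    exact (hind.comp measurable_snd measurable_id).symm
  have hYc : P[Y | m] = Y :=
    condExp_of_stronglyMeasurable hY.comap_le (comap_measurable Y).stronglyMeasurable hY1
  have hsum : P[fun ω => c * X ω + b * Y ω + V ω | m]
      =ᵐ[P] fun ω => c * k (Y ω) + b * Y ω + P[V] := by
    have h1 := condExp_add (m := m) ((hX1.const_mul c).add (hY1.const_mul b)) hV1
    have h2 := condExp_add (m := m) (hX1.const_mul c) (hY1.const_mul b)
    have h3 : P[fun ω => c * X ω | m] =ᵐ[P] c • P[X | m] := condExp_smul (μ := P) c X m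
    have h4 : P[fun ω => b * Y ω | m] =ᵐ[P] b • P[Y | m] := condExp_smul (μ := P) b Y m
    filter_upwards [h1, h2, h3, h4, hXk, hVc] with ω h1 h2 h3 h4 h5 h6
    have h1' : (P[fun ω => c * X ω + b * Y ω + V ω | m]) ω = _ := h1
    rw [h1', Pi.add_apply, h2, Pi.add_apply, h3, h4, Pi.smul_apply, Pi.smul_apply, h5, h6, hYc]
    rfl
  have hkL : MemLp (fun ω => k (Y ω)) 2 P := (hX.condExp one_le_two).ae_eq hXk
  have hE : MemLp (fun ω => X ω - k (Y ω)) 2 P := hX.sub hkL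
  have hW : MemLp (fun ω => V ω - P[V]) 2 P := hV.sub (memLp_const _)
  have hcross : ∫ ω, (X ω - k (Y ω)) * (V ω - P[V]) ∂P = 0 := by
    have hi : IndepFun (fun ω => X ω - k (Y ω)) (fun ω => V ω - P[V]) P :=
      hind.comp (φ := fun p : ℝ × ℝ => p.1 - k p.2) (ψ := fun v : ℝ => v - ∫ ω, V ω ∂P)
        (by fun_prop) (by fun_prop)
    rw [hi.integral_fun_mul_eq_mul_integral hE.1 hW.1, integral_sub hV1 (integrable_const _)]
    simp
  have hL : ∫ ω, (c * X ω + b * Y ω + V ω - (P[fun ω => c * X ω + b * Y ω + V ω | m]) ω) ^ 2 ∂P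
      = ∫ ω, (c ^ 2 * (X ω - k (Y ω)) ^ 2 + 2 * c * ((X ω - k (Y ω)) * (V ω - P[V]))
          + (V ω - P[V]) ^ 2) ∂P := by
    refine integral_congr_ae ?_
    filter_upwards [hsum] with ω hω
    rw [hω]
    ring
  have hR : ∫ ω, (X ω - (P[X | m]) ω) ^ 2 ∂P = ∫ ω, (X ω - k (Y ω)) ^ 2 ∂P := by
    refine integral_congr_ae ?_
    filter_upwards [hXk] with ω hω
    rw [hω]
  have hi1 : Integrable (fun ω => (X ω - k (Y ω)) * (V ω - P[V])) P := hE.integrable_mul hW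
  have hi2 : Integrable (fun ω => c ^ 2 * (X ω - k (Y ω)) ^ 2) P := hE.integrable_sq.const_mul _
  have hi3 : Integrable (fun ω => 2 * c * ((X ω - k (Y ω)) * (V ω - P[V]))) P := hi1.const_mul _
  have hi4 : Integrable (fun ω => c ^ 2 * (X ω - k (Y ω)) ^ 2
      + 2 * c * ((X ω - k (Y ω)) * (V ω - P[V]))) P := hi2.add hi3
  rw [hL, hR, integral_add hi4 hW.integrable_sq, integral_add hi2 hi3,
    integral_const_mul, integral_const_mul, hcross, variance_eq_integral hVm.aemeasurable]
  ring

/-- Gaussian regression: the residual of `X` after its linear estimate from `β X + Z` is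
independent of `β X + Z`. -/
lemma gaussian_regression [IsProbabilityMeasure P] {X Z : Ω → ℝ} (hX : Measurable X)
    (hZ : Measurable Z) (hXlaw : P.map X = gaussianReal 0 1) (hZlaw : P.map Z = gaussianReal 0 1)
    (h : IndepFun X Z P) (β : ℝ) :
    P.map (fun ω => β * X ω + Z ω) = (gaussianReal 0 1).map (fun z => √(1 + β ^ 2) * z) ∧
    IndepFun (fun ω => β * X ω + Z ω) (fun ω => X ω - β / (1 + β ^ 2) * (β * X ω + Z ω)) P ∧
    Var[fun ω => X ω - β / (1 + β ^ 2) * (β * X ω + Z ω); P] = 1 / (1 + β ^ 2) := by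
  have ha : (1 + β ^ 2) ≠ 0 := by positivity
  have hXG : HasGaussianLaw X P := ⟨by rw [hXlaw]; infer_instance⟩
  have hZG : HasGaussianLaw Z P := ⟨by rw [hZlaw]; infer_instance⟩
  have hVX : Var[X; P] = 1 := by
    have := variance_id_map hX.aemeasurable (μ := P)
    rw [← this, hXlaw]; simp
  have hVZ : Var[Z; P] = 1 := by
    have := variance_id_map hZ.aemeasurable (μ := P)
    rw [← this, hZlaw]; simp
  have hcov : cov[X, Z; P] = 0 := h.covariance_eq_zero hXG.memLp_two hZG.memLp_two
  have e : (fun ω => X ω - β / (1 + β ^ 2) * (β * X ω + Z ω))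
      = fun ω => (1 / (1 + β ^ 2)) * X ω + (-β / (1 + β ^ 2)) * Z ω := by
    ext ω; field_simp; ring
  refine ⟨?_, ?_, ?_⟩
  · have h1 : P.map (fun ω => β * X ω) = gaussianReal (β * 0) (.mk (β ^ 2) (sq_nonneg _) * 1) := by
      rw [← gaussianReal_map_const_mul, ← hXlaw, Measure.map_map (by fun_prop) hX]; rfl
    have h2 := gaussianReal_add_gaussianReal_of_indepFun
      (h.comp (φ := fun x => β * x) (ψ := id) (by fun_prop) measurable_id) h1 hZlaw
    refine h2.trans ?_
    rw [gaussianReal_map_const_mul]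
    congr 1
    · ring
    · apply NNReal.eq
      simp only [NNReal.coe_add, NNReal.coe_mul, NNReal.coe_one, NNReal.coe_mk]
      rw [Real.sq_sqrt (by positivity)]; ring
  -- The two variables form a linear image of the Gaussian pair `(X, Z)`, so zero covariance
  -- suffices. The coefficient `β / (1 + β²)` is covariance over variance, chosen to achieve it.
  · have hG := (IndepFun.hasGaussianLaw hXG hZG h).map_fun
      (((β • ContinuousLinearMap.fst ℝ ℝ ℝ) + ContinuousLinearMap.snd ℝ ℝ ℝ).prod
        (((1 / (1 + β ^ 2)) • ContinuousLinearMap.fst ℝ ℝ ℝ)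
          + (-β / (1 + β ^ 2)) • ContinuousLinearMap.snd ℝ ℝ ℝ))
    rw [e]
    refine HasGaussianLaw.indepFun_of_covariance_eq_zero (by simpa using hG) ?_
    refine (covariance_add_left (hXG.memLp_two.const_mul β) hZG.memLp_two
      ((hXG.memLp_two.const_mul (1 / (1 + β ^ 2))).add
        (hZG.memLp_two.const_mul (-β / (1 + β ^ 2))))).trans ?_
    rw [covariance_add_right (hXG.memLp_two.const_mul β) (hXG.memLp_two.const_mul _)
        (hZG.memLp_two.const_mul _),
      covariance_add_right hZG.memLp_two (hXG.memLp_two.const_mul _)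
        (hZG.memLp_two.const_mul _)]
    simp only [covariance_const_mul_left, covariance_const_mul_right, hcov,
      covariance_comm Z X, covariance_self hX.aemeasurable, covariance_self hZ.aemeasurable,
      hVX, hVZ]
    ring
  · rw [e, IndepFun.variance_fun_add (hXG.memLp_two.const_mul _) (hZG.memLp_two.const_mul _)
      (h.comp (measurable_const_mul _) (measurable_const_mul _)), variance_const_mul,
      variance_const_mul, hVX, hVZ]
    field_simp

end Mmse

/-! ### Joint laws of independent variables -/

section Law

variable {Ω Ω' : Type*} [MeasurableSpace Ω] [MeasurableSpace Ω'] {P : Measure Ω} {P' : Measure Ω'}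

/-- The law of a function of two independent variables depends on the marginals only. -/
lemma map_comp_eq_of_indepFun [IsFiniteMeasure P] [IsFiniteMeasure P']
    {α β γ : Type*} [MeasurableSpace α] [MeasurableSpace β] [MeasurableSpace γ]
    {X : Ω → α} {Z : Ω → β} {X' : Ω' → α} {Z' : Ω' → β}
    (hX : Measurable X) (hZ : Measurable Z) (hX' : Measurable X') (hZ' : Measurable Z')
    (h : IndepFun X Z P) (h' : IndepFun X' Z' P')
    (hXX' : P.map X = P'.map X') (hZZ' : P.map Z = P'.map Z') {f : α × β → γ}
    (hf : Measurable f) :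
    P.map (fun ω => f (X ω, Z ω)) = P'.map (fun ω => f (X' ω, Z' ω)) := by
  have e : P.map (fun ω => (X ω, Z ω)) = P'.map (fun ω => (X' ω, Z' ω)) := by
    rw [(indepFun_iff_map_prod_eq_prod_map_map hX.aemeasurable hZ.aemeasurable).1 h,
      (indepFun_iff_map_prod_eq_prod_map_map hX'.aemeasurable hZ'.aemeasurable).1 h', hXX', hZZ']
  have e' := congrArg (Measure.map f) e
  rwa [Measure.map_map hf (hX.prodMk hZ), Measure.map_map hf (hX'.prodMk hZ')] at e'

/-- If `X` is independent of `(N, V)`, and `N` of `V`, then `(X, N)` is independent of `V`. -/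
lemma indepFun_prodMk_left_of_prodMk_right [IsProbabilityMeasure P]
    {α β γ : Type*} [MeasurableSpace α] [MeasurableSpace β] [MeasurableSpace γ]
    {X : Ω → α} {N : Ω → β} {V : Ω → γ}
    (hX : Measurable X) (hN : Measurable N) (hV : Measurable V)
    (h : IndepFun X (fun ω => (N ω, V ω)) P) (h' : IndepFun N V P) :
    IndepFun (fun ω => (X ω, N ω)) V P := by
  have : IsProbabilityMeasure (P.map X) := Measure.isProbabilityMeasure_map hX.aemeasurable
  have : IsProbabilityMeasure (P.map N) := Measure.isProbabilityMeasure_map hN.aemeasurable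
  have : IsProbabilityMeasure (P.map V) := Measure.isProbabilityMeasure_map hV.aemeasurable
  have h1 := (indepFun_iff_map_prod_eq_prod_map_map hX.aemeasurable
    (hN.prodMk hV).aemeasurable).1 h
  have h2 := (indepFun_iff_map_prod_eq_prod_map_map hN.aemeasurable hV.aemeasurable).1 h'
  have h3 : IndepFun X N P := h.comp measurable_id measurable_fst
  rw [indepFun_iff_map_prod_eq_prod_map_map (hX.prodMk hN).aemeasurable hV.aemeasurable,
    (indepFun_iff_map_prod_eq_prod_map_map hX.aemeasurable hN.aemeasurable).1 h3]
  rw [h2, ← Measure.prodAssoc_prod] at h1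
  have h4 := congrArg (Measure.map MeasurableEquiv.prodAssoc.symm) h1
  rw [Measure.map_map (MeasurableEquiv.measurable _) (hX.prodMk (hN.prodMk hV)),
    Measure.map_map (MeasurableEquiv.measurable _) (MeasurableEquiv.measurable _)] at h4
  rw [MeasurableEquiv.symm_comp_self, Measure.map_id] at h4
  exact h4

end Law

/-! ### Gaussian mixtures as channel inputs -/

section Mix

variable {Ω Ω' : Type*} [MeasurableSpace Ω] [MeasurableSpace Ω'] {P : Measure Ω} {P' : Measure Ω'}

/-- Removing a Gaussian component from the input of a Gaussian channel. -/
lemma mmse_add_gaussian [IsProbabilityMeasure P] {X G Z : Ω → ℝ}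
    (hX : Measurable X) (hG : Measurable G) (hZ : Measurable Z) (hX2 : MemLp X 2 P)
    (hGlaw : P.map G = gaussianReal 0 1) (hZlaw : P.map Z = gaussianReal 0 1)
    (h : IndepFun X (fun ω => (G ω, Z ω)) P) (hGZ : IndepFun G Z P) (r c d : ℝ) :
    mmse P (fun ω => c * X ω + d * G ω) (fun ω => r * (c * X ω + d * G ω) + Z ω) =
      (c / (1 + (r * d) ^ 2)) ^ 2 *
        mmse P X (fun ω => r * (c * X ω + d * G ω) + Z ω) + d ^ 2 / (1 + (r * d) ^ 2) := by
  obtain ⟨-, hNV, hvar⟩ := gaussian_regression hG hZ hGlaw hZlaw hGZ (r * d)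
  set a := 1 + (r * d) ^ 2 with ha
  have ha0 : a ≠ 0 := by positivity
  set V : Ω → ℝ := fun ω => G ω - r * d / a * (r * d * G ω + Z ω) with hV
  have hGL : MemLp G 2 P := (⟨by rw [hGlaw]; infer_instance⟩ : HasGaussianLaw G P).memLp_two
  have hZL : MemLp Z 2 P := (⟨by rw [hZlaw]; infer_instance⟩ : HasGaussianLaw Z P).memLp_two
  have hVL : MemLp V 2 P := hGL.sub (((hGL.const_mul (r * d)).add hZL).const_mul (r * d / a))
  have hYL : MemLp (fun ω => r * (c * X ω + d * G ω) + Z ω) 2 P :=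
    (((hX2.const_mul c).add (hGL.const_mul d)).const_mul r).add hZL
  have h3 : IndepFun (fun ω => (X ω, r * d * G ω + Z ω)) V P := by
    refine indepFun_prodMk_left_of_prodMk_right hX (by fun_prop) (by fun_prop) ?_ hNV
    exact h.comp (φ := id)
      (ψ := fun p : ℝ × ℝ => (r * d * p.1 + p.2, p.1 - r * d / a * (r * d * p.1 + p.2)))
      measurable_id (by fun_prop)
  -- The output is `r c X + N`, a function of `(X, N)`.
  have h4 : IndepFun (fun ω => (X ω, r * (c * X ω + d * G ω) + Z ω)) (fun ω => d * V ω) P := by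
    have := h3.comp (φ := fun p : ℝ × ℝ => (p.1, r * c * p.1 + p.2)) (ψ := fun v => d * v)
      (by fun_prop) (by fun_prop)
    refine this.congr (Filter.Eventually.of_forall fun ω => ?_) Filter.EventuallyEq.rfl
    simp only [Function.comp, Prod.mk.injEq, true_and]
    ring
  have key := mmse_affine_add_indep (r * d ^ 2 / a) (c / a)
    (show Measurable fun ω => r * (c * X ω + d * G ω) + Z ω by fun_prop)
    (show Measurable fun ω => d * V ω by fun_prop) hX2 hYL (hVL.const_mul d) h4
  -- Substitute `N = Y - r c X` in `G = V + (r d / a) N`; the coefficient of `X` becomes `c - c (r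
  -- d)² / a = c / a`.
  have e : (fun ω => c / a * X ω + r * d ^ 2 / a * (r * (c * X ω + d * G ω) + Z ω) + d * V ω)
      = fun ω => c * X ω + d * G ω := by
    ext ω
    simp only [hV]
    field_simp
    rw [ha]
    ring
  rw [e, variance_const_mul, hvar] at key
  rw [key]
  ring

/-- The minimum mean squared error of a Gaussian input. -/
lemma mmse_gaussian [IsProbabilityMeasure P] {G Z : Ω → ℝ}
    (hG : Measurable G) (hZ : Measurable Z)
    (hGlaw : P.map G = gaussianReal 0 1) (hZlaw : P.map Z = gaussianReal 0 1)
    (hGZ : IndepFun G Z P) (r : ℝ) :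
    mmse P G (fun ω => r * G ω + Z ω) = 1 / (1 + r ^ 2) := by
  -- Zero non-Gaussian component: only the residual variance survives.
  have := mmse_add_gaussian (X := fun _ => 0) measurable_const hG hZ (memLp_const _) hGlaw hZlaw
    (indepFun_const_left (0 : ℝ) _) hGZ r 0 1
  simpa using this

/-- A Gaussian channel whose input is a mixture has, jointly with either the input or its
non-Gaussian component, the law that is obtained on the canonical product space. -/
lemma exists_canonical_mixture [IsProbabilityMeasure P] {X G Z W : Ω → ℝ}
    (hX : Measurable X) (hG : Measurable G) (hZ : Measurable Z) (hW : Measurable W)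
    (hGlaw : P.map G = gaussianReal 0 1) (hZlaw : P.map Z = gaussianReal 0 1)
    (hWlaw : P.map W = gaussianReal 0 1) (hXG : IndepFun X G P) (r c d : ℝ)
    (hmix : IndepFun (fun ω => c * X ω + d * G ω) Z P) (hXW : IndepFun X W P) :
    ∃ (P' : Measure (ℝ × ℝ × ℝ)) (_ : IsProbabilityMeasure P'),
      P'.map (fun p => p.1) = P.map X ∧ P'.map (fun p => p.2.1) = gaussianReal 0 1 ∧
      P'.map (fun p => p.2.2) = gaussianReal 0 1 ∧
      IndepFun (fun p : ℝ × ℝ × ℝ => p.1) (fun p => (p.2.1, p.2.2)) P' ∧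
      IndepFun (fun p : ℝ × ℝ × ℝ => p.2.1) (fun p => p.2.2) P' ∧
      P.map (fun ω => (r * (c * X ω + d * G ω) + Z ω, c * X ω + d * G ω)) =
        P'.map (fun p => (r * (c * p.1 + d * p.2.1) + p.2.2, c * p.1 + d * p.2.1)) ∧
      P'.map (fun p => (r * (c * p.1 + d * p.2.1) + p.2.2, p.1)) =
        P.map (fun ω => (r * c * X ω + √(1 + (r * d) ^ 2) * W ω, X ω)) := by
  have hXp : IsProbabilityMeasure (P.map X) := Measure.isProbabilityMeasure_map hX.aemeasurable
  let γ := gaussianReal 0 1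
  let P' : Measure (ℝ × ℝ × ℝ) := (P.map X).prod (γ.prod γ)
  have m1 : P'.map (fun p => p.1) = P.map X := Measure.fst_prod
  have m23 : P'.map (fun p => p.2) = γ.prod γ := Measure.snd_prod
  have m2 : P'.map (fun p => p.2.1) = γ := by
    have : P'.map (fun p => p.2.1) = (P'.map (fun p => p.2)).map Prod.fst := by
      rw [Measure.map_map measurable_fst measurable_snd]; rfl
    rw [this, m23]; exact Measure.fst_prod
  have m3 : P'.map (fun p => p.2.2) = γ := by
    have : P'.map (fun p => p.2.2) = (P'.map (fun p => p.2)).map Prod.snd := by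
      rw [Measure.map_map measurable_snd measurable_snd]; rfl
    rw [this, m23]; exact Measure.snd_prod
  have i1 : IndepFun (fun p : ℝ × ℝ × ℝ => p.1) (fun p => (p.2.1, p.2.2)) P' := by
    have := indepFun_prod (μ := P.map X) (ν := γ.prod γ) measurable_id measurable_id
    exact this
  have i2 : IndepFun (fun p : ℝ × ℝ × ℝ => p.2.1) (fun p => p.2.2) P' := by
    rw [indepFun_iff_map_prod_eq_prod_map_map (by fun_prop) (by fun_prop), m2, m3]
    exact m23
  refine ⟨P', inferInstance, m1, m2, m3, i1, i2, ?_, ?_⟩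
  · have hmix' : IndepFun (fun p : ℝ × ℝ × ℝ => c * p.1 + d * p.2.1) (fun p => p.2.2) P' :=
      (indepFun_prodMk_left_of_prodMk_right measurable_fst (by fun_prop) (by fun_prop) i1 i2).comp
        (φ := fun q : ℝ × ℝ => c * q.1 + d * q.2) (ψ := id) (by fun_prop) measurable_id
    have hm : P.map (fun ω => c * X ω + d * G ω) = P'.map (fun p => c * p.1 + d * p.2.1) :=
      map_comp_eq_of_indepFun (f := fun q : ℝ × ℝ => c * q.1 + d * q.2)
        hX hG measurable_fst (by fun_prop) hXG
        (i1.comp (φ := id) (ψ := Prod.fst) measurable_id measurable_fst)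
        m1.symm (hGlaw.trans m2.symm) (by fun_prop)
    exact map_comp_eq_of_indepFun (f := fun q : ℝ × ℝ => (r * q.1 + q.2, q.1))
      (by fun_prop) hZ (by fun_prop) (by fun_prop) hmix hmix' hm (hZlaw.trans m3.symm)
      (by fun_prop)
  -- Here `r d G + Z` is replaced by `√(1 + (r d)²) W`, which has the same law and is also
  -- independent of `X`.
  · have hN := (gaussian_regression (P := P') (X := fun p => p.2.1) (Z := fun p => p.2.2)
      (by fun_prop) (by fun_prop) m2 m3 i2 (r * d)).1
    have hsW : P.map (fun ω => √(1 + (r * d) ^ 2) * W ω)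
        = (gaussianReal 0 1).map (fun z => √(1 + (r * d) ^ 2) * z) := by
      rw [← hWlaw, Measure.map_map (by fun_prop) hW]; rfl
    have := map_comp_eq_of_indepFun (f := fun q : ℝ × ℝ => (r * c * q.1 + q.2, q.1))
      (P := P') (P' := P) (X := fun p => p.1) (Z := fun p => r * d * p.2.1 + p.2.2)
      (X' := X) (Z' := fun ω => √(1 + (r * d) ^ 2) * W ω)
      measurable_fst (by fun_prop) hX (by fun_prop)
      (i1.comp (φ := id) (ψ := fun q : ℝ × ℝ => r * d * q.1 + q.2) measurable_id (by fun_prop))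
      (hXW.comp (φ := id) (ψ := fun w => √(1 + (r * d) ^ 2) * w) measurable_id (by fun_prop))
      m1 (hN.trans hsW.symm) (by fun_prop)
    rw [← this]
    congr 1
    ext p
    · simp only; ring
    · rfl

/-- The output law and the minimum mean squared error of a Gaussian channel whose input is a
mixture, in terms of a channel whose input is the non-Gaussian component. -/
lemma mixture_channel [IsProbabilityMeasure P] {X G Z W : Ω → ℝ}
    (hX : Measurable X) (hG : Measurable G) (hZ : Measurable Z) (hW : Measurable W)
    (hX2 : MemLp X 2 P)
    (hGlaw : P.map G = gaussianReal 0 1) (hZlaw : P.map Z = gaussianReal 0 1)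
    (hWlaw : P.map W = gaussianReal 0 1) (hXG : IndepFun X G P) (r c d q : ℝ)
    (hq : √(1 + (r * d) ^ 2) * q = r * c)
    (hmix : IndepFun (fun ω => c * X ω + d * G ω) Z P) (hXW : IndepFun X W P) :
    P.map (fun ω => r * (c * X ω + d * G ω) + Z ω) =
        (P.map fun ω => q * X ω + W ω).map (fun y => √(1 + (r * d) ^ 2) * y) ∧
      mmse P (fun ω => c * X ω + d * G ω) (fun ω => r * (c * X ω + d * G ω) + Z ω) =
        (c / (1 + (r * d) ^ 2)) ^ 2 * mmse P X (fun ω => q * X ω + W ω)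
          + d ^ 2 / (1 + (r * d) ^ 2) := by
  obtain ⟨P', _, m1, m2, m3, i1, i2, e1, e2⟩ :=
    exists_canonical_mixture hX hG hZ hW hGlaw hZlaw hWlaw hXG r c d hmix hXW
  have hs : √(1 + (r * d) ^ 2) ≠ 0 := by positivity
  have e3 : (fun ω => (r * c * X ω + √(1 + (r * d) ^ 2) * W ω, X ω))
      = fun ω => (√(1 + (r * d) ^ 2) * (q * X ω + W ω), X ω) := by
    ext ω
    · simp only; rw [← hq]; ring
    · rfl
  rw [e3] at e2
  have hGL : MemLp G 2 P := (⟨by rw [hGlaw]; infer_instance⟩ : HasGaussianLaw G P).memLp_two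
  have hGL' : MemLp (fun p : ℝ × ℝ × ℝ => p.2.1) 2 P' :=
    (⟨by rw [m2]; infer_instance⟩ : HasGaussianLaw _ P').memLp_two
  have hXL' : MemLp (fun p : ℝ × ℝ × ℝ => p.1) 2 P' := by
    have h1 : MemLp id 2 (P.map X) := (memLp_map_measure_iff (by fun_prop) hX.aemeasurable).2 hX2
    rw [← m1] at h1
    exact (memLp_map_measure_iff (f := fun p : ℝ × ℝ × ℝ => p.1) (by fun_prop)
      (by fun_prop)).1 h1
  constructor
  · have f1 := congrArg (Measure.map Prod.fst) e1
    have f2 := congrArg (Measure.map Prod.fst) e2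
    rw [Measure.map_map measurable_fst (by fun_prop), Measure.map_map measurable_fst (by fun_prop)]
      at f1 f2
    rw [Measure.map_map (by fun_prop) (by fun_prop)]
    exact f1.trans f2
  · have hm : Integrable (fun ω => c * X ω + d * G ω) P :=
      ((hX2.const_mul c).add (hGL.const_mul d)).integrable one_le_two
    have hm' : Integrable (fun p : ℝ × ℝ × ℝ => c * p.1 + d * p.2.1) P' :=
      ((hXL'.const_mul c).add (hGL'.const_mul d)).integrable one_le_two
    rw [mmse_eq_of_map_eq hm hm'
        (by fun_prop) (by fun_prop) (by fun_prop) (by fun_prop) e1,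
      mmse_add_gaussian measurable_fst (by fun_prop) (by fun_prop) hXL' m2 m3 i1 i2,
      mmse_eq_of_map_eq (hXL'.integrable one_le_two) (hX2.integrable one_le_two)
        (by fun_prop) (by fun_prop) hX (by fun_prop) e2, mmse_const_mul_right _ _ hs]

end Mix

/-! ### Densities, entropy and mutual information -/

section Info

variable {Ω : Type*} [MeasurableSpace Ω] {P : Measure Ω}

/-- The joint law of the input and the output of a Gaussian channel has the Gaussian
conditional density. -/
lemma map_prodMk_channel_eq_withDensity [IsProbabilityMeasure P] {X Z : Ω → ℝ}
    (hX : Measurable X) (hZ : Measurable Z) (hZlaw : P.map Z = gaussianReal 0 1)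
    (h : IndepFun X Z P) (r : ℝ) :
    P.map (fun ω => (X ω, r * X ω + Z ω)) =
      ((P.map X).prod volume).withDensity (fun p => gaussianPDF 0 1 (p.2 - r * p.1)) := by
  have hXp : IsProbabilityMeasure (P.map X) := Measure.isProbabilityMeasure_map hX.aemeasurable
  have hg : Measurable fun p : ℝ × ℝ => gaussianPDF 0 1 (p.2 - r * p.1) :=
    (measurable_gaussianPDF 0 1).comp (by fun_prop)
  have e1 : P.map (fun ω => (X ω, r * X ω + Z ω)) =
      ((P.map X).prod (gaussianReal 0 1)).map (fun p => (p.1, r * p.1 + p.2)) := by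
    rw [← hZlaw,
      ← (indepFun_iff_map_prod_eq_prod_map_map hX.aemeasurable hZ.aemeasurable).1 h,
      Measure.map_map (by fun_prop) (by fun_prop)]
    rfl
  rw [e1]
  refine Measure.ext_of_lintegral _ fun f hf => ?_
  rw [lintegral_map hf (by fun_prop), lintegral_withDensity_eq_lintegral_mul _ hg hf,
    lintegral_prod _ (by fun_prop), lintegral_prod _ (by fun_prop)]
  refine lintegral_congr fun x => ?_
  -- For fixed `x`, translation by `r x` turns the noise density into the conditional output
  -- density.
  rw [gaussianReal_of_var_ne_zero 0 one_ne_zero,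
    lintegral_withDensity_eq_lintegral_mul _ (measurable_gaussianPDF 0 1) (by fun_prop),
    ← lintegral_sub_right_eq_self _ (r * x)]
  refine lintegral_congr fun y => ?_
  simp

lemma map_channel_eq_withDensity [IsProbabilityMeasure P] {X Z : Ω → ℝ}
    (hX : Measurable X) (hZ : Measurable Z) (hZlaw : P.map Z = gaussianReal 0 1)
    (h : IndepFun X Z P) (r : ℝ) :
    P.map (fun ω => r * X ω + Z ω) =
      volume.withDensity (fun y => ∫⁻ x, gaussianPDF 0 1 (y - r * x) ∂(P.map X)) := by
  have hXp : IsProbabilityMeasure (P.map X) := Measure.isProbabilityMeasure_map hX.aemeasurable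
  have hg : Measurable fun p : ℝ × ℝ => gaussianPDF 0 1 (p.2 - r * p.1) :=
    (measurable_gaussianPDF 0 1).comp (by fun_prop)
  have hg' : Measurable fun p : ℝ × ℝ => gaussianPDF 0 1 (p.1 - r * p.2) :=
    (measurable_gaussianPDF 0 1).comp (by fun_prop)
  have e1 : P.map (fun ω => r * X ω + Z ω)
      = (P.map (fun ω => (X ω, r * X ω + Z ω))).map Prod.snd := by
    rw [Measure.map_map (by fun_prop) (by fun_prop)]; rfl
  rw [e1, map_prodMk_channel_eq_withDensity hX hZ hZlaw h r]
  refine Measure.ext_of_lintegral _ fun f hf => ?_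
  rw [lintegral_map hf (by fun_prop), lintegral_withDensity_eq_lintegral_mul _ hg (by fun_prop),
    lintegral_prod_symm _ (by fun_prop),
    lintegral_withDensity_eq_lintegral_mul _ hg'.lintegral_prod_right' hf]
  refine lintegral_congr fun y => ?_
  simp only [Pi.mul_apply]
  rw [lintegral_mul_const _ (by fun_prop)]

/-- The negative differential entropy of a measure on the real line. -/
noncomputable def negEntropy (ν : Measure ℝ) : ℝ := ∫ y, Real.log (ν.rnDeriv volume y).toReal ∂ν

/-- The density of the image at `a y` is `1 / a` times that of `ν` at `y`. Splitting the logarithm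
needs a positive finite density, which holds `ν`-almost everywhere. -/
lemma negEntropy_map_const_mul (ν : Measure ℝ) [IsProbabilityMeasure ν] (hν : ν ≪ volume)
    (hint : Integrable (fun y => Real.log (ν.rnDeriv volume y).toReal) ν) {a : ℝ} (ha : 0 < a) :
    negEntropy (ν.map (a * ·)) = negEntropy ν - Real.log a := by
  have hm : Measurable fun y : ℝ => a * y := by fun_prop
  have he : MeasurableEmbedding fun y : ℝ => a * y :=
    (Homeomorph.mulLeft₀ a ha.ne').measurableEmbedding
  have : IsProbabilityMeasure (ν.map (a * ·)) := Measure.isProbabilityMeasure_map hm.aemeasurable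
  have h1 := he.rnDeriv_map ν volume
  have h2 := Measure.rnDeriv_smul_right_of_ne_top (ν.map (a * ·)) volume
    (r := ENNReal.ofReal |a⁻¹|) (by simpa using ha.ne') ENNReal.ofReal_ne_top
  rw [← Real.map_volume_mul_left ha.ne'] at h2
  have h2' : ∀ᵐ y, (ν.map (a * ·)).rnDeriv (volume.map (a * ·)) (a * y)
      = ((ENNReal.ofReal |a⁻¹|)⁻¹ • (ν.map (a * ·)).rnDeriv volume) (a * y) := by
    refine ae_of_ae_map hm.aemeasurable (Measure.AbsolutelyContinuous.ae_le ?_ h2)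
    rw [Real.map_volume_mul_left ha.ne']
    exact Measure.smul_absolutelyContinuous
  have h3 : ∀ᵐ y ∂ν, Real.log ((ν.map (a * ·)).rnDeriv volume (a * y)).toReal
      = Real.log (ν.rnDeriv volume y).toReal - Real.log a := by
    filter_upwards [hν.ae_le h1, hν.ae_le h2', Measure.rnDeriv_pos hν,
      hν.ae_le (Measure.rnDeriv_lt_top ν volume)] with y h1 h2 h3 h4
    rw [h1, Pi.smul_apply, smul_eq_mul] at h2
    have h5 : (ν.rnDeriv volume y).toReal
        = a * ((ν.map (a * ·)).rnDeriv volume (a * y)).toReal := by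
      rw [h2, ENNReal.toReal_mul, ENNReal.toReal_inv, ENNReal.toReal_ofReal (abs_nonneg _),
        abs_of_pos (inv_pos.2 ha), inv_inv]
    have h6 : 0 < (ν.rnDeriv volume y).toReal := ENNReal.toReal_pos h3.ne' h4.ne
    have h7 : ((ν.map (a * ·)).rnDeriv volume (a * y)).toReal ≠ 0 := by
      intro h; rw [h, mul_zero] at h5; exact h6.ne' h5
    rw [h5, Real.log_mul ha.ne' h7]
    ring
  rw [negEntropy, integral_map hm.aemeasurable
    ((Measure.measurable_rnDeriv _ _).ennreal_toReal.log.aestronglyMeasurable),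
    integral_congr_ae h3, integral_sub hint (integrable_const _), negEntropy]
  simp

lemma negEntropy_gaussianReal :
    negEntropy (gaussianReal 0 1) = ∫ z, Real.log (gaussianPDFReal 0 1 z) ∂(gaussianReal 0 1) := by
  refine integral_congr_ae ?_
  filter_upwards [(gaussianReal_absolutelyContinuous 0 one_ne_zero).ae_le
    (rnDeriv_gaussianReal 0 1)] with z hz
  rw [hz, toReal_gaussianPDF]

lemma log_gaussianPDFReal_standard (z : ℝ) :
    Real.log (gaussianPDFReal 0 1 z) = -Real.log √(2 * Real.pi) - z ^ 2 / 2 := by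
  rw [gaussianPDFReal, Real.log_mul (by positivity) (by positivity), Real.log_exp, Real.log_inv]
  simp
  ring

lemma gaussianPDFReal_standard_le_one (z : ℝ) : gaussianPDFReal 0 1 z ≤ 1 := by
  rw [← Real.log_nonpos_iff (gaussianPDFReal_nonneg _ _ _), log_gaussianPDFReal_standard]
  have : 0 ≤ Real.log √(2 * Real.pi) := by
    refine Real.log_nonneg ?_
    rw [Real.one_le_sqrt]
    nlinarith [Real.pi_gt_three]
  nlinarith [sq_nonneg z]

lemma integrable_log_rnDeriv_gaussianReal :
    Integrable (fun z => Real.log ((gaussianReal 0 1).rnDeriv volume z).toReal)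
      (gaussianReal 0 1) := by
  have h : Integrable (fun z => Real.log (gaussianPDFReal 0 1 z)) (gaussianReal 0 1) := by
    simp only [log_gaussianPDFReal_standard]
    exact (integrable_const _).sub ((memLp_id_gaussianReal 2).integrable_sq.div_const 2)
  refine h.congr ?_
  filter_upwards [(gaussianReal_absolutelyContinuous 0 one_ne_zero).ae_le
    (rnDeriv_gaussianReal 0 1)] with z hz
  rw [hz, toReal_gaussianPDF]

/-- Bounds for the logarithm of a Gaussian smoothing of a law with finite second moment. -/
lemma abs_log_integral_gaussianPDFReal_le (μ : Measure ℝ) [IsProbabilityMeasure μ]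
    (hμ : Integrable (fun x => x ^ 2) μ) (r y : ℝ) :
    0 < ∫ x, gaussianPDFReal 0 1 (y - r * x) ∂μ ∧
    |Real.log (∫ x, gaussianPDFReal 0 1 (y - r * x) ∂μ)|
      ≤ Real.log √(2 * Real.pi) + y ^ 2 + r ^ 2 * ∫ x, x ^ 2 ∂μ := by
  set C := Real.log √(2 * Real.pi) with hC
  -- Since `(y - r x)² / 2 ≤ y² + r² x²`, the log-density is at least `-C - y² - r² x²`, whose
  -- `μ`-mean is `L`. Jensen's inequality, through the tangent line of `exp` at `L`, bounds the
  -- smoothed density below by `exp L`.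
  set L := -C - y ^ 2 - r ^ 2 * ∫ x, x ^ 2 ∂μ with hL
  have hmeas : Measurable fun x => gaussianPDFReal 0 1 (y - r * x) :=
    (measurable_gaussianPDFReal 0 1).comp (by fun_prop)
  have hint : Integrable (fun x => gaussianPDFReal 0 1 (y - r * x)) μ := by
    refine Integrable.of_bound hmeas.aestronglyMeasurable 1 (Filter.Eventually.of_forall fun x => ?_)
    rw [Real.norm_of_nonneg (gaussianPDFReal_nonneg _ _ _)]
    exact gaussianPDFReal_standard_le_one _
  have hup : ∫ x, gaussianPDFReal 0 1 (y - r * x) ∂μ ≤ 1 := by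
    have := integral_mono hint (integrable_const (1 : ℝ))
      (fun x => gaussianPDFReal_standard_le_one (y - r * x))
    simpa using this
  have hpt : ∀ x, Real.exp L * (-C - y ^ 2 - r ^ 2 * x ^ 2 - L + 1)
      ≤ gaussianPDFReal 0 1 (y - r * x) := by
    intro x
    have h1 : Real.exp (-C - y ^ 2 - r ^ 2 * x ^ 2) ≤ gaussianPDFReal 0 1 (y - r * x) := by
      rw [← Real.le_log_iff_exp_le (gaussianPDFReal_pos _ _ _ one_ne_zero),
        log_gaussianPDFReal_standard]
      nlinarith [sq_nonneg (y + r * x)]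
    refine le_trans ?_ h1
    have h2 : Real.exp (-C - y ^ 2 - r ^ 2 * x ^ 2)
        = Real.exp L * Real.exp (-C - y ^ 2 - r ^ 2 * x ^ 2 - L) := by
      rw [← Real.exp_add]; congr 1; ring
    rw [h2]
    exact mul_le_mul_of_nonneg_left (Real.add_one_le_exp _) (Real.exp_pos _).le
  have hlow : Real.exp L ≤ ∫ x, gaussianPDFReal 0 1 (y - r * x) ∂μ := by
    have e : (fun x => Real.exp L * (-C - y ^ 2 - r ^ 2 * x ^ 2 - L + 1))
        = fun x => Real.exp L * (-C - y ^ 2 - L + 1) - Real.exp L * r ^ 2 * x ^ 2 := by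
      ext x; ring
    have hi : Integrable (fun x => Real.exp L * (-C - y ^ 2 - r ^ 2 * x ^ 2 - L + 1)) μ := by
      rw [e]; exact (integrable_const _).sub (hμ.const_mul _)
    have := integral_mono hi hint hpt
    rw [e, integral_sub (integrable_const _) (hμ.const_mul _), integral_const,
      integral_const_mul, probReal_univ, one_smul] at this
    refine le_trans (le_of_eq ?_) this
    linear_combination (-Real.exp L) * hL
  have hpos := (Real.exp_pos L).trans_le hlow
  refine ⟨hpos, ?_⟩
  rw [abs_of_nonpos (Real.log_nonpos hpos.le hup)]
  have := (Real.le_log_iff_exp_le hpos).2 hlow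
  linarith

/-- The information density of a Gaussian channel is integrable, and the mutual information is
the difference of the differential entropies of the output and of the noise. -/
lemma mutualInfo_channel [IsProbabilityMeasure P] {X Z : Ω → ℝ}
    (hX : Measurable X) (hZ : Measurable Z) (hX2 : MemLp X 2 P)
    (hZlaw : P.map Z = gaussianReal 0 1) (h : IndepFun X Z P) (r : ℝ) :
    (P.map fun ω => r * X ω + Z ω) ≪ volume ∧
    Integrable (fun y => Real.log ((P.map fun ω => r * X ω + Z ω).rnDeriv volume y).toReal)
      (P.map fun ω => r * X ω + Z ω) ∧
    Integrable (infoDensity P X (fun ω => r * X ω + Z ω)) P ∧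
    mutualInfo P X (fun ω => r * X ω + Z ω) =
      negEntropy (gaussianReal 0 1) - negEntropy (P.map fun ω => r * X ω + Z ω) := by
  have hXp : IsProbabilityMeasure (P.map X) := Measure.isProbabilityMeasure_map hX.aemeasurable
  set Y : Ω → ℝ := fun ω => r * X ω + Z ω with hYdef
  have hY : Measurable Y := by fun_prop
  have hZL : MemLp Z 2 P := (⟨by rw [hZlaw]; infer_instance⟩ : HasGaussianLaw Z P).memLp_two
  have hYL : MemLp Y 2 P := (hX2.const_mul r).add hZL
  have hX2' : Integrable (fun x => x ^ 2) (P.map X) :=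
    (integrable_map_measure (by fun_prop) hX.aemeasurable).2 hX2.integrable_sq
  have hjoint := map_prodMk_channel_eq_withDensity hX hZ hZlaw h r
  have hout := map_channel_eq_withDensity hX hZ hZlaw h r
  have hg : Measurable fun p : ℝ × ℝ => gaussianPDF 0 1 (p.2 - r * p.1) :=
    (measurable_gaussianPDF 0 1).comp (by fun_prop)
  have hg' : Measurable fun p : ℝ × ℝ => gaussianPDF 0 1 (p.1 - r * p.2) :=
    (measurable_gaussianPDF 0 1).comp (by fun_prop)
  have hac : P.map Y ≪ volume := by rw [hout]; exact withDensity_absolutelyContinuous _ _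
  have hlog : ∀ᵐ y ∂(P.map Y), ((P.map Y).rnDeriv volume y).toReal
      = ∫ x, gaussianPDFReal 0 1 (y - r * x) ∂(P.map X) := by
    have h1 : (P.map Y).rnDeriv volume =ᵐ[volume]
        fun y => ∫⁻ x, gaussianPDF 0 1 (y - r * x) ∂(P.map X) := by
      rw [hout]; exact Measure.rnDeriv_withDensity volume hg'.lintegral_prod_right'
    filter_upwards [hac.ae_le h1] with y hy
    rw [hy]
    rw [integral_eq_lintegral_of_nonneg_ae
      (Filter.Eventually.of_forall fun x => gaussianPDFReal_nonneg _ _ _)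
      ((measurable_gaussianPDFReal 0 1).comp (by fun_prop)).aestronglyMeasurable]
    rfl
  have hbd := fun y => abs_log_integral_gaussianPDFReal_le (P.map X) hX2' r y
  have hint : Integrable (fun y => Real.log ((P.map Y).rnDeriv volume y).toReal) (P.map Y) := by
    have hi : Integrable (fun y => Real.log √(2 * Real.pi) + y ^ 2
        + r ^ 2 * ∫ x, x ^ 2 ∂(P.map X)) (P.map Y) := by
      refine ((integrable_const _).add ?_).add (integrable_const _)
      exact (integrable_map_measure (by fun_prop) hY.aemeasurable).2 hYL.integrable_sq
    refine hi.mono' ((Measure.measurable_rnDeriv _ _).ennreal_toReal.log.aestronglyMeasurable) ?_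
    filter_upwards [hlog] with y hy
    rw [hy]
    exact (hbd y).2
  -- Along the channel `Y - r X = Z`, so the conditional density is the noise density at `Z`.
  have hcond : ∀ᵐ ω ∂P, condDensity P X Y (X ω, Y ω) = gaussianPDFReal 0 1 (Z ω) := by
    have h1 : (P.map fun ω => (X ω, Y ω)).rnDeriv ((P.map X).prod volume)
        =ᵐ[(P.map X).prod volume] fun p => gaussianPDF 0 1 (p.2 - r * p.1) := by
      rw [hjoint]; exact Measure.rnDeriv_withDensity _ hg
    have hac' : (P.map fun ω => (X ω, Y ω)) ≪ (P.map X).prod volume := by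
      rw [hjoint]; exact withDensity_absolutelyContinuous _ _
    filter_upwards [ae_of_ae_map (by fun_prop) (hac'.ae_le h1)] with ω hω
    rw [condDensity, hω, toReal_gaussianPDF]
    congr 1
    simp [hYdef]
  have hinfo : infoDensity P X Y =ᵐ[P] fun ω => Real.log (gaussianPDFReal 0 1 (Z ω))
      - Real.log ((P.map Y).rnDeriv volume (Y ω)).toReal := by
    filter_upwards [hcond, ae_of_ae_map hY.aemeasurable hlog] with ω h1 h2
    rw [infoDensity, h1, pdf_def]
    refine Real.log_div (gaussianPDFReal_pos _ _ _ one_ne_zero).ne' ?_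
    rw [h2]
    exact (hbd _).1.ne'
  have hi1 : Integrable (fun ω => Real.log (gaussianPDFReal 0 1 (Z ω))) P := by
    simp only [log_gaussianPDFReal_standard]
    exact (integrable_const _).sub (hZL.integrable_sq.div_const 2)
  have hi2 : Integrable (fun ω => Real.log ((P.map Y).rnDeriv volume (Y ω)).toReal) P :=
    hint.comp_measurable hY
  refine ⟨hac, hint, (hi1.sub hi2).congr hinfo.symm, ?_⟩
  rw [mutualInfo, integral_congr_ae hinfo, integral_sub hi1 hi2, negEntropy_gaussianReal,
    ← hZlaw, negEntropy, integral_map hZ.aemeasurable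
      (measurable_gaussianPDFReal 0 1).log.aestronglyMeasurable,
    integral_map hY.aemeasurable
      ((Measure.measurable_rnDeriv _ _).ennreal_toReal.log.aestronglyMeasurable)]

end Info

/-! ### The decomposition -/

theorem mainTheorem7 {Ω : Type*} [MeasurableSpace Ω] (P : Measure Ω) [IsProbabilityMeasure P]
    (δ snr : ℝ) (hδ0 : 0 ≤ δ) (hδ1 : δ ≤ 1) (hsnr : 0 ≤ snr)
    -- the two components of the mixed input
    (XD XG : Ω → ℝ) (hXD : Measurable XD) (hXG : Measurable XG)
    (hXD2 : MemLp XD 2 P) (hXDpow : ∫ ω, XD ω ^ 2 ∂P ≤ 1)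
    (hXGlaw : P.map XG = gaussianReal 0 1) (hDG : IndepFun XD XG P)
    -- the standard Gaussian noises of the three channels, each independent of the channel's input
    (Zmix ZD ZG : Ω → ℝ) (hZmix : Measurable Zmix) (hZD : Measurable ZD) (hZG : Measurable ZG)
    (hZmixlaw : P.map Zmix = gaussianReal 0 1) (hZDlaw : P.map ZD = gaussianReal 0 1)
    (hZGlaw : P.map ZG = gaussianReal 0 1)
    (hmix_indep : IndepFun (mixedInput δ XD XG) Zmix P)
    (hD_indep : IndepFun XD ZD P) (hG_indep : IndepFun XG ZG P)
    -- the outputs of the three channels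
    (Ymix YD YG : Ω → ℝ)
    (hYmix : Ymix = channelOutput snr (mixedInput δ XD XG) Zmix)
    (hYD : YD = channelOutput (snr * (1 - δ) / (1 + δ * snr)) XD ZD)
    (hYG : YG = channelOutput (δ * snr) XG ZG) :
    -- the three mutual informations are expectations of integrable random variables
    (Integrable (infoDensity P (mixedInput δ XD XG) Ymix) P ∧
      Integrable (infoDensity P XD YD) P ∧
      Integrable (infoDensity P XG YG) P) ∧
    mutualInfo P (mixedInput δ XD XG) Ymix = mutualInfo P XD YD + mutualInfo P XG YG ∧
    mmse P (mixedInput δ XD XG) Ymix =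
      (1 - δ) / (1 + δ * snr) ^ 2 * mmse P XD YD + δ * mmse P XG YG := by
  have hr : √snr * √δ = √(δ * snr) := by rw [Real.sqrt_mul hδ0, mul_comm]
  have hr2 : (√snr * √δ) ^ 2 = δ * snr := by rw [hr, Real.sq_sqrt (by positivity)]
  have ha : 0 < 1 + δ * snr := by positivity
  have hδ : 0 ≤ 1 - δ := by linarith
  -- The reduced snr is what makes `√a` factor out of the output.
  have hq : √(1 + (√snr * √δ) ^ 2) * √(snr * (1 - δ) / (1 + δ * snr)) = √snr * √(1 - δ) := by
    rw [hr2, ← Real.sqrt_mul ha.le, mul_div_cancel₀ _ ha.ne', Real.sqrt_mul hsnr]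
  have hXGL : MemLp XG 2 P := (⟨by rw [hXGlaw]; infer_instance⟩ : HasGaussianLaw XG P).memLp_two
  have hXm : Measurable (mixedInput δ XD XG) := by unfold mixedInput; fun_prop
  have hXmL : MemLp (mixedInput δ XD XG) 2 P :=
    (hXD2.const_mul √(1 - δ)).add (hXGL.const_mul √δ)
  obtain ⟨hlaw, hmmse⟩ := mixture_channel hXD hXG hZmix hZD hXD2 hXGlaw hZmixlaw hZDlaw hDG
    (√snr) (√(1 - δ)) (√δ) _ hq hmix_indep hD_indep
  obtain ⟨-, -, im, em⟩ := mutualInfo_channel hXm hZmix hXmL hZmixlaw hmix_indep √snr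
  obtain ⟨acD, intD, iD, eD⟩ := mutualInfo_channel hXD hZD hXD2 hZDlaw hD_indep
    √(snr * (1 - δ) / (1 + δ * snr))
  obtain ⟨-, -, iG, eG⟩ := mutualInfo_channel hXG hZG hXGL hZGlaw hG_indep √(δ * snr)
  have hYDm : Measurable fun ω => √(snr * (1 - δ) / (1 + δ * snr)) * XD ω + ZD ω := by fun_prop
  have : IsProbabilityMeasure (P.map fun ω => √(snr * (1 - δ) / (1 + δ * snr)) * XD ω + ZD ω) :=
    Measure.isProbabilityMeasure_map hYDm.aemeasurable
  have hs : 0 < √(1 + δ * snr) := Real.sqrt_pos.2 ha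
  have hlawG := (gaussian_regression hXG hZG hXGlaw hZGlaw hG_indep √(δ * snr)).1
  have hmmseG := mmse_gaussian hXG hZG hXGlaw hZGlaw hG_indep √(δ * snr)
  rw [Real.sq_sqrt (by positivity)] at hlawG hmmseG
  rw [hr2] at hlaw hmmse
  -- Both entropies shift by the same `log √(1 + δ snr)`, relative to the `X_D`-output here and to
  -- the standard Gaussian in `hEG`.
  have hEm : negEntropy (P.map fun ω => √snr * mixedInput δ XD XG ω + Zmix ω) = _ :=
    (congrArg negEntropy hlaw).trans (negEntropy_map_const_mul _ acD intD hs)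
  have hEG := (congrArg negEntropy hlawG).trans (negEntropy_map_const_mul _
    (gaussianReal_absolutelyContinuous 0 one_ne_zero) integrable_log_rnDeriv_gaussianReal hs)
  subst hYmix hYD hYG
  refine ⟨⟨im, iD, iG⟩, ?_, ?_⟩
  · refine em.trans ?_
    refine Eq.trans ?_ (congrArg₂ (· + ·) eD eG).symm
    simp only [hEm, hEG]
    ring
  · refine hmmse.trans ?_
    refine Eq.trans ?_ (congrArg (fun u => (1 - δ) / (1 + δ * snr) ^ 2 *
      mmse P XD (channelOutput (snr * (1 - δ) / (1 + δ * snr)) XD ZD) + δ * u) hmmseG).symm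
    unfold channelOutput
    rw [div_pow, Real.sq_sqrt hδ, Real.sq_sqrt hδ0]
    ring
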